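/- Let $D\sim\mathcal D(n,p)$ with $p=c/n$, where $c>1$ is fixed, be the random directed graph on $[n]$ in which each ordered pair $(i,j)$, $i\ne j$, is a directed edge independently with probability $p$ (no loops). For a vertex $v$ let $d_D(v)=\min\{d_D^+(v),d_D^-(v)\}$ be the minimum of its out-degree and in-degree, and let $Z=\{v: d_D(v)\le 3\}$. Let $G$ be the undirected graph underlying $D$ (distinct $u,v$ are adjacent in $G$ if $(u,v)$ or $(v,u)$ is an edge of $D$). Define sets of vertices by $X_0=\emptyset$ and, for $k\ge1$, let $X_k$ be the set of all $v\notin\bigcup_{j<k}X_j$ for which there are $x\neq y$ in $\big(\bigcup_{j<k}X_j\big)\cup Z$ such that $v$ is a vertex (possibly an endpoint) of a path of length at most $4$ in $G$ between $x$ and $y$. Let $X=\bigcup_k X_k$. Then there is an absolute constant $c_0$ such that for every fixed $c>1$ with $c\ge c_0$, $$\mathbb P\big(|X|\le (2c)^{10}e^{-2c}\,n\big)\longrightarrow 1\qquad\text{as } n\to\infty .$$ -/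

import Mathlib

open MeasureTheory ProbabilityTheory Filter Topology

noncomputable section

namespace Digraph

variable {V : Type*}

/-- The out-degree `d⁺(v)`: the number of `u` with an edge from `v` to `u`. -/
def outDeg (D : Digraph V) (v : V) : ℕ := {u | D.Adj v u}.ncard

/-- The in-degree `d⁻(v)`: the number of `u` with an edge from `u` to `v`. -/
def inDeg (D : Digraph V) (v : V) : ℕ := {u | D.Adj u v}.ncard

/-- `d(v) = min (d⁺(v), d⁻(v))`. -/
def minDeg (D : Digraph V) (v : V) : ℕ := min (D.outDeg v) (D.inDeg v)

/-- The digraph whose set of directed edges is `S`. -/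
def ofEdgeSet (S : Set (V × V)) : Digraph V where
  Adj u v := (u, v) ∈ S

/-- Every set of digraphs is an event (only used for finite vertex sets). -/
instance : MeasurableSpace (Digraph V) := ⊤

/-- The random digraph `𝒟(V, p)`: each ordered pair `(u, v)` with `u ≠ v` is a directed edge
independently and with probability `p`; there are no loops. -/
def binomialRandom (V : Type*) [Finite V] (p : unitInterval) : Measure (Digraph V) :=
  (setBernoulli {e : V × V | e.1 ≠ e.2} p).map ofEdgeSet

theorem measurable_ofEdgeSet [Finite V] : Measurable (ofEdgeSet (V := V)) :=
  measurable_of_finite _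

instance (V : Type*) [Finite V] (p : unitInterval) :
    IsProbabilityMeasure (binomialRandom V p) :=
  Measure.isProbabilityMeasure_map measurable_ofEdgeSet.aemeasurable

end Digraph

namespace SimpleGraph

variable {V : Type*}

/-- The vertices outside `U` that lie on a path of length at most `4` joining two distinct
vertices of `U ∪ Z`. -/
def filterStep (G : SimpleGraph V) (Z U : Set V) : Set V :=
  {v | v ∉ U ∧ ∃ x ∈ U ∪ Z, ∃ y ∈ U ∪ Z, x ≠ y ∧
    ∃ w : G.Walk x y, w.IsPath ∧ w.length ≤ 4 ∧ v ∈ w.support}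

/-- The sequence `X₀ = ∅`, `X_k = filterStep G Z (⋃ j < k, X_j)` for `k ≥ 1`. -/
def filterSeq (G : SimpleGraph V) (Z : Set V) : ℕ → Set V
  | 0 => ∅
  | k + 1 => filterStep G Z (⋃ j : Fin (k + 1), filterSeq G Z j)
  termination_by k => k
  decreasing_by exact j.2

/-- The set `X(G, Z) = ⋃ k, X_k` produced by the filtering process. -/
def filterSet (G : SimpleGraph V) (Z : Set V) : Set V := ⋃ k, filterSeq G Z k

end SimpleGraph

end

/-!
Write `ε = (2c)^10 e^{-2c}` and `Z = {v | d(v) ≤ 3}`. If the filtering process produces more than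
`ε n` vertices, then a set `S` with between `ε n` and `ε n + 5` vertices is obtained by adding one
short path at a time (`exists_isCluster_of_lt_ncard`): as long as the set `S` built so far does not
contain everything, some path of length at most `4` between distinct vertices of `S ∪ Z` leaves
`S`, and it may be cut so that its inner vertices avoid `S`. Let `e` and `z` count the edges and the
vertices of `Z` collected in `S`. Adding a path increases `φ = 2 (e - |S|) + z` by two if both ends
lie in `S` and by one if one end does; `φ` is unchanged if neither does, but then the path is
disjoint from all earlier ones and joins two vertices of `Z`. Hence all but `4 φ` vertices of `S`
lie on disjoint paths of length `1`, ..., `4` between vertices of `Z`.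

A vertex `v ∈ S` with `d(v) ≤ 3` has at most three out-neighbours or at most three in-neighbours
outside `S`. The corresponding edges are distinct for distinct `v` and differ from those inside
`S`, so if `S` is small, `e` given edges inside `S` and `z` given vertices of `S` in `Z` occur
together with probability at most `(c / n)^e Q^z`, where `Q = c^3 e^{-c} / 2`
(`binomialRandom_real_edges_minDeg_le`, `sum_powerset_card_le_three_le`). Two first moment bounds follow.

* For each `l ≤ 4` there are at least `r = ε n / 20` disjoint paths of length `l` between vertices
  of `Z` with probability at most `(n (2c)^l Q^2)^r / r! ≤ 4^{-r}` (`real_hasZPaths_le`,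
  `zPaths_bound`). This is the only place where the
  factor `2 ^ 10` and the exponent `10` in `ε` matter; elsewhere powers of `c` are negligible.
* Otherwise the disjoint paths cover at most `7 / 10` of `S`, so `φ ≥ |S| / 20`. As `|S| / n` is
  `Q^2` up to a polynomial in `c`, the expected number of such sets `S` with their edges and
  vertices of `Z` is at most `(poly(c) Q^{1/20})^{|S|} ≤ 2^{-|S|}` for large `c`
  (`real_exists_isWitness_le`, `witness_bound`).
-/

noncomputable section

/-! ### Edges and small degrees in the random digraph -/

namespace Digraph

variable {V : Type*}

/-- The directed edge between `v` and `u`, leaving `v` if `b` holds and entering `v` otherwise. -/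
def orient (b : Bool) (v u : V) : V × V := if b then (v, u) else (u, v)

variable [Fintype V] [DecidableEq V]

/-- The probability that a given set of directed edges is present and another is absent. -/
theorem binomialRandom_real_cylinder (p : unitInterval) {A B : Finset (V × V)}
    (hAB : Disjoint A B) (hA : ∀ e ∈ A, e.1 ≠ e.2) (hB : ∀ e ∈ B, e.1 ≠ e.2) :
    (binomialRandom V p).real
      {D | (∀ e ∈ A, D.Adj e.1 e.2) ∧ ∀ e ∈ B, ¬ D.Adj e.1 e.2} =
      (p : ℝ) ^ A.card * (1 - p : ℝ) ^ B.card := by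
  have h : (binomialRandom V p)
      {D | (∀ e ∈ A, D.Adj e.1 e.2) ∧ ∀ e ∈ B, ¬ D.Adj e.1 e.2} =
      (unitInterval.toNNReal p : ENNReal) ^ A.card *
        (unitInterval.toNNReal (unitInterval.symm p) : ENNReal) ^ B.card := by
    rw [binomialRandom, Measure.map_apply measurable_ofEdgeSet (MeasurableSpace.measurableSet_top),
      setBernoulli_apply']
    have : ((fun q : V × V → Prop ↦ {i | q i}) ⁻¹' (ofEdgeSet ⁻¹'
        {D | (∀ e ∈ A, D.Adj e.1 e.2) ∧ ∀ e ∈ B, ¬ D.Adj e.1 e.2})) =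
        Set.pi ((A ∪ B : Finset (V × V)) : Set (V × V))
          (fun e ↦ if e ∈ A then {True} else {False}) := by
      ext q
      simp only [ofEdgeSet, Set.mem_preimage, Set.mem_ofPred_eq, Set.mem_pi, Finset.coe_union,
        Set.mem_union, Finset.mem_coe]
      constructor
      · rintro ⟨h1, h2⟩ e he
        split_ifs with hA
        · simpa using h1 e hA
        · simpa using h2 e (he.resolve_left hA)
      · intro h
        refine ⟨fun e he ↦ ?_, fun e he ↦ ?_⟩
        · simpa [he] using h e (Or.inl he)
        · simpa [Finset.disjoint_right.1 hAB he] using h e (Or.inr he)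
    rw [this, Measure.infinitePi_pi _ (fun _ _ ↦ MeasurableSpace.measurableSet_top), Finset.prod_union hAB]
    congr 1
    · rw [Finset.prod_congr rfl (g := fun _ ↦ (unitInterval.toNNReal p : ENNReal)),
        Finset.prod_const]
      intro e he
      simp [he, hA e he]
    · rw [Finset.prod_congr rfl
        (g := fun _ ↦ (unitInterval.toNNReal (unitInterval.symm p) : ENNReal)), Finset.prod_const]
      intro e he
      simp [Finset.disjoint_right.1 hAB he, hB e he]
  rw [measureReal_def, h]
  simp

/-- Edges inside `S` and the edges between `S` and its complement are independent, and a vertex of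
`S` with small in- or out-degree has few edges from or to the complement. -/
theorem binomialRandom_real_edges_minDeg_le (p : unitInterval) (S Z : Finset V)
    (F : Finset (V × V)) (hZ : Z ⊆ S) (hF : F ⊆ S.offDiag) (k : ℕ) :
    (binomialRandom V p).real
      {D | (∀ e ∈ F, D.Adj e.1 e.2) ∧ ∀ v ∈ Z, D.minDeg v ≤ k} ≤
      (p : ℝ) ^ F.card *
        (2 * ∑ A ∈ Sᶜ.powerset with A.card ≤ k,
          (p : ℝ) ^ A.card * (1 - p : ℝ) ^ (Sᶜ.card - A.card)) ^ Z.card := by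
  classical
  -- `g v = (b, A)` records that the out-neighbourhood (`b = true`) or in-neighbourhood of `v`
  -- outside `S` is exactly `A`; the event is covered by one cylinder event for each such `g`.
  set 𝒜 := {A ∈ Sᶜ.powerset | A.card ≤ k} with h𝒜
  let t : {v // v ∈ Z} → Finset (Bool × Finset V) := fun _ ↦ Finset.univ ×ˢ 𝒜
  let P : ({v // v ∈ Z} → Bool × Finset V) → Finset (V × V) := fun g ↦
    F ∪ Finset.univ.biUnion fun v ↦ (g v).2.image (orient (g v).1 v.1)
  let N : ({v // v ∈ Z} → Bool × Finset V) → Finset (V × V) := fun g ↦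
    Finset.univ.biUnion fun v ↦ (Sᶜ \ (g v).2).image (orient (g v).1 v.1)
  have horient : ∀ {b b' : Bool} {v v' u u' : V}, v ∈ S → v' ∈ S → u ∉ S → u' ∉ S →
      orient b v u = orient b' v' u' → v = v' ∧ u = u' ∧ b = b' := by
    intro b b' v v' u u' hv hv' hu hu' h
    cases b <;> cases b' <;> simp only [orient] at h <;> grind
  have hcover : {D : Digraph V | (∀ e ∈ F, D.Adj e.1 e.2) ∧ ∀ v ∈ Z, D.minDeg v ≤ k} ⊆
      ⋃ g ∈ Fintype.piFinset t,
        {D | (∀ e ∈ P g, D.Adj e.1 e.2) ∧ ∀ e ∈ N g, ¬ D.Adj e.1 e.2} := by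
    rintro D ⟨hD1, hD2⟩
    have key : ∀ v : {v // v ∈ Z}, ∃ x : Bool × Finset V, x.2 ∈ 𝒜 ∧
        ∀ u ∈ Sᶜ, (u ∈ x.2 ↔ D.Adj (orient x.1 v.1 u).1 (orient x.1 v.1 u).2) := by
      rintro ⟨v, hv⟩
      rcases min_le_iff.1 (hD2 v hv) with h | h
      · refine ⟨(true, {u ∈ Sᶜ | D.Adj v u}), ?_, fun u hu ↦ ?_⟩
        · simp only [h𝒜, Finset.mem_filter, Finset.mem_powerset, Finset.filter_subset, true_and]
          refine le_trans ?_ h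
          rw [outDeg, ← Set.ncard_coe_finset]
          exact Set.ncard_le_ncard (fun u hu ↦ by simp at hu; exact hu.2) (Set.toFinite _)
        · rw [Finset.mem_filter]; simp [orient, Finset.mem_compl.1 hu]
      · refine ⟨(false, {u ∈ Sᶜ | D.Adj u v}), ?_, fun u hu ↦ ?_⟩
        · simp only [h𝒜, Finset.mem_filter, Finset.mem_powerset, Finset.filter_subset, true_and]
          refine le_trans ?_ h
          rw [inDeg, ← Set.ncard_coe_finset]
          exact Set.ncard_le_ncard (fun u hu ↦ by simp at hu; exact hu.2) (Set.toFinite _)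
        · rw [Finset.mem_filter]; simp [orient, Finset.mem_compl.1 hu]
    choose g hg1 hg2 using key
    refine Set.mem_biUnion (x := g) ?_ ⟨fun e he ↦ ?_, fun e he ↦ ?_⟩
    · simp [t, hg1]
    · rcases Finset.mem_union.1 he with he | he
      · exact hD1 e he
      · simp only [Finset.mem_biUnion, Finset.mem_univ, true_and, Finset.mem_image] at he
        obtain ⟨v, u, hu, rfl⟩ := he
        exact (hg2 v u (Finset.mem_powerset.1 (Finset.mem_filter.1 (hg1 v)).1 hu)).1 hu
    · simp only [N, Finset.mem_biUnion, Finset.mem_univ, true_and, Finset.mem_image,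
        Finset.mem_sdiff] at he
      obtain ⟨v, u, ⟨hu, hu'⟩, rfl⟩ := he
      exact fun h ↦ hu' ((hg2 v u hu).2 h)
  have hcyl : ∀ g ∈ Fintype.piFinset t, (binomialRandom V p).real
      {D | (∀ e ∈ P g, D.Adj e.1 e.2) ∧ ∀ e ∈ N g, ¬ D.Adj e.1 e.2} =
      (p : ℝ) ^ F.card * ∏ v, ((p : ℝ) ^ (g v).2.card *
        (1 - p : ℝ) ^ (Sᶜ.card - (g v).2.card)) := by
    intro g hg
    have hg2 : ∀ v, (g v).2 ⊆ Sᶜ := fun v ↦ by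
      have := Fintype.mem_piFinset.1 hg v
      simp only [t, Finset.mem_product, h𝒜, Finset.mem_filter, Finset.mem_powerset] at this
      exact this.2.1
    have hout : ∀ v u, u ∈ (g v).2 → u ∉ S := fun v u hu ↦ Finset.mem_compl.1 (hg2 v hu)
    have hcard : ∀ f : {v // v ∈ Z} → Finset V, (∀ v, f v ⊆ Sᶜ) →
        (Finset.univ.biUnion fun v ↦ (f v).image (orient (g v).1 v.1)).card =
          ∑ v, (f v).card := by
      intro f hf
      rw [Finset.card_biUnion]
      · refine Finset.sum_congr rfl fun v _ ↦ Finset.card_image_of_injOn ?_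
        intro u hu u' hu' h
        exact (horient (hZ v.2) (hZ v.2) (Finset.mem_compl.1 (hf v hu))
          (Finset.mem_compl.1 (hf v hu')) h).2.1
      · intro v _ v' _ hvv'
        refine Finset.disjoint_left.2 fun e he he' ↦ ?_
        obtain ⟨u, hu, rfl⟩ := Finset.mem_image.1 he
        obtain ⟨u', hu', h⟩ := Finset.mem_image.1 he'
        exact hvv' (Subtype.ext (horient (hZ v'.2) (hZ v.2) (Finset.mem_compl.1 (hf v' hu'))
          (Finset.mem_compl.1 (hf v hu)) h).1.symm)
    have hne : ∀ b (v : {v // v ∈ Z}) u, u ∉ S →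
        orient b v.1 u ∉ F ∧ (orient b v.1 u).1 ≠ (orient b v.1 u).2 := by
      intro b v u hu
      have hv := hZ v.2
      refine ⟨fun h ↦ ?_, ?_⟩
      · have := Finset.mem_offDiag.1 (hF h)
        cases b <;> simp_all [orient]
      · cases b <;> simp only [orient] <;> grind
    rw [binomialRandom_real_cylinder]
    · rw [Finset.prod_mul_distrib, Finset.prod_pow_eq_pow_sum, Finset.prod_pow_eq_pow_sum,
        ← mul_assoc, ← pow_add]
      congr 2
      · rw [Finset.card_union_of_disjoint, hcard _ hg2]
        rw [Finset.disjoint_right]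
        intro e he
        simp only [Finset.mem_biUnion, Finset.mem_univ, true_and, Finset.mem_image] at he
        obtain ⟨v, u, hu, rfl⟩ := he
        exact (hne _ v u (hout v u hu)).1
      · rw [hcard _ (fun v ↦ Finset.sdiff_subset)]
        exact Finset.sum_congr rfl fun v _ ↦ Finset.card_sdiff_of_subset (hg2 v)
    · rw [Finset.disjoint_right]
      intro e he he'
      simp only [N, Finset.mem_biUnion, Finset.mem_univ, true_and, Finset.mem_image,
        Finset.mem_sdiff, Finset.mem_compl] at he
      obtain ⟨v, u, ⟨hu, hu'⟩, rfl⟩ := he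
      rcases Finset.mem_union.1 he' with he' | he'
      · exact (hne _ v u hu).1 he'
      · simp only [Finset.mem_biUnion, Finset.mem_univ, true_and, Finset.mem_image] at he'
        obtain ⟨v', u', h1, h2⟩ := he'
        obtain ⟨h3, h4, -⟩ := horient (hZ v'.2) (hZ v.2) (hout _ _ h1) hu h2
        obtain rfl := Subtype.ext h3
        exact hu' (h4 ▸ h1)
    · intro e he
      rcases Finset.mem_union.1 he with he | he
      · exact (Finset.mem_offDiag.1 (hF he)).2.2
      · simp only [Finset.mem_biUnion, Finset.mem_univ, true_and, Finset.mem_image] at he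
        obtain ⟨v, u, hu, rfl⟩ := he
        exact (hne _ v u (hout v u hu)).2
    · intro e he
      simp only [N, Finset.mem_biUnion, Finset.mem_univ, true_and, Finset.mem_image,
        Finset.mem_sdiff, Finset.mem_compl] at he
      obtain ⟨v, u, ⟨hu, hu'⟩, rfl⟩ := he
      exact (hne _ v u hu).2
  calc _ ≤ (binomialRandom V p).real (⋃ g ∈ Fintype.piFinset t,
        {D | (∀ e ∈ P g, D.Adj e.1 e.2) ∧ ∀ e ∈ N g, ¬ D.Adj e.1 e.2}) :=
        measureReal_mono hcover (measure_ne_top _ _)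
    _ ≤ ∑ g ∈ Fintype.piFinset t, (binomialRandom V p).real
        {D | (∀ e ∈ P g, D.Adj e.1 e.2) ∧ ∀ e ∈ N g, ¬ D.Adj e.1 e.2} :=
        measureReal_biUnion_finset_le _ _
    _ = (p : ℝ) ^ F.card * ∑ g ∈ Fintype.piFinset t, ∏ v, ((p : ℝ) ^ (g v).2.card *
        (1 - p : ℝ) ^ (Sᶜ.card - (g v).2.card)) := by
        rw [Finset.sum_congr rfl hcyl, Finset.mul_sum]
    _ = _ := by
        rw [← Finset.prod_univ_sum t fun _ x ↦
          (p : ℝ) ^ x.2.card * (1 - p : ℝ) ^ (Sᶜ.card - x.2.card)]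
        congr 1
        simp only [t, Finset.prod_const, Finset.card_univ, Fintype.card_coe, Finset.sum_product]
        simp

end Digraph

/-! ### Clusters built up by short paths -/

namespace SimpleGraph

variable {V : Type*} {G : SimpleGraph V} {Z : Set V}

/-- A set that is not left by any short path between distinct vertices of `S ∪ Z` contains the
result of the filtering process. -/
theorem filterSet_subset {S : Set V}
    (h : ∀ x ∈ S ∪ Z, ∀ y ∈ S ∪ Z, x ≠ y → ∀ w : G.Walk x y, w.IsPath → w.length ≤ 4 →
      ∀ v ∈ w.support, v ∈ S) :
    G.filterSet Z ⊆ S := by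
  refine Set.iUnion_subset fun k ↦ ?_
  induction k using Nat.strong_induction_on with
  | _ k ih =>
    match k with
    | 0 => simp [filterSeq]
    | k + 1 =>
      rw [filterSeq]
      rintro v ⟨-, x, hx, y, hy, hxy, w, hw, hl, hv⟩
      have hU : (⋃ j : Fin (k + 1), filterSeq G Z j) ⊆ S := Set.iUnion_subset fun j ↦ ih j j.2
      exact h x (Set.union_subset_union_left _ hU hx) y (Set.union_subset_union_left _ hU hy)
        hxy w hw hl v hv

/-- A path leaving `S` between two vertices of `S ∪ Z` may be cut down to one whose inner vertices
avoid `S`. -/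
theorem exists_isPath_inner_notMem {S : Set V} {x y : V} (hx : x ∈ S ∪ Z) (hy : y ∈ S ∪ Z)
    (hxy : x ≠ y) (w : G.Walk x y) (hw : w.IsPath) {v : V} (hv : v ∈ w.support) (hvS : v ∉ S) :
    ∃ x' ∈ S ∪ Z, ∃ y' ∈ S ∪ Z, x' ≠ y' ∧ ∃ w' : G.Walk x' y', w'.IsPath ∧
      w'.length ≤ w.length ∧ (∃ v ∈ w'.support, v ∉ S) ∧
      ∀ u ∈ w'.support, u ≠ x' → u ≠ y' → u ∉ S := by
  classical
  induction hn : w.length using Nat.strong_induction_on generalizing x y with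
  | _ n ih =>
    subst hn
    by_cases h : ∀ u ∈ w.support, u ≠ x → u ≠ y → u ∉ S
    · exact ⟨x, hx, y, hy, hxy, w, hw, le_rfl, ⟨v, hv, hvS⟩, h⟩
    · push Not at h
      obtain ⟨u, hu, hux, huy, huS⟩ := h
      have hlen := congrArg Walk.length (w.take_spec hu)
      rw [Walk.length_append] at hlen
      have h1 : 0 < (w.takeUntil u hu).length :=
        Nat.pos_of_ne_zero fun h0 ↦ hux (Walk.eq_of_length_eq_zero h0).symm
      have h2 : 0 < (w.dropUntil u hu).length :=
        Nat.pos_of_ne_zero fun h0 ↦ huy (Walk.eq_of_length_eq_zero h0)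
      rw [← w.take_spec hu, Walk.mem_support_append_iff] at hv
      rcases hv with hv | hv
      · obtain ⟨x', hx', y', hy', hne, w', hw', hl, hr⟩ :=
          ih _ (by lia) hx (Or.inl huS) hux.symm _ (hw.takeUntil hu) hv rfl
        exact ⟨x', hx', y', hy', hne, w', hw', by lia, hr⟩
      · obtain ⟨x', hx', y', hy', hne, w', hw', hl, hr⟩ :=
          ih _ (by lia) (Or.inl huS) hy huy _ (hw.dropUntil hu) hv rfl
        exact ⟨x', hx', y', hy', hne, w', hw', by lia, hr⟩

end SimpleGraph

namespace Digraph

variable {V : Type*} {D : Digraph V} {Z : Set V}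

theorem exists_adj_orient {u w : V} (h : D.toSimpleGraphInclusive.Adj u w) :
    ∃ b, D.Adj (orient b u w).1 (orient b u w).2 := by
  rcases h.2 with h | h
  · exact ⟨true, h⟩
  · exact ⟨false, h⟩

/-- A sequence of `l + 1` vertices together with a choice of direction for each of the `l` pairs of
consecutive ones. -/
abbrev OrientedSeq (V : Type*) (l : ℕ) : Type _ := (Fin (l + 1) → V) × (Fin l → Bool)

/-- The directed edge that an oriented sequence prescribes between its `i`-th vertex and the
next. -/
def OrientedSeq.edge {l : ℕ} (r : OrientedSeq V l) (i : Fin l) : V × V :=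
  orient (r.2 i) (r.1 i.castSucc) (r.1 i.succ)

theorem OrientedSeq.edge_injective {l : ℕ} {r : OrientedSeq V l} (hr : Function.Injective r.1) :
    Function.Injective r.edge := by
  intro i j h
  have h1 : ∀ {i j : Fin l}, r.1 i.castSucc = r.1 j.castSucc → i = j := fun h ↦
    Fin.castSucc_injective _ (hr h)
  have h2 : ∀ {i j : Fin l}, r.1 i.succ = r.1 j.succ → i = j := fun h ↦
    Fin.succ_injective _ (hr h)
  have h3 : ∀ {i j : Fin l}, r.1 i.castSucc = r.1 j.succ → i.val = j.val + 1 := fun h ↦ by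
    simpa using congrArg Fin.val (hr h)
  unfold edge orient at h
  split_ifs at h <;> rw [Prod.mk.injEq] at h
  · exact h1 h.1
  · have := h3 h.1; have := h3 h.2.symm; lia
  · have := h3 h.2; have := h3 h.1.symm; lia
  · exact h1 h.2

/-- `r` is a path in the graph underlying `D`, with directions realised in `D`, between two
vertices of `Z`. -/
def IsZPath (D : Digraph V) (Z : Set V) {l : ℕ} (r : OrientedSeq V l) : Prop :=
  Function.Injective r.1 ∧ (∀ i, D.Adj (r.edge i).1 (r.edge i).2) ∧
    r.1 0 ∈ Z ∧ r.1 (Fin.last l) ∈ Z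

/-- A path between two vertices of `Z`, as an oriented sequence. -/
theorem exists_isZPath {x y : V} (w : D.toSimpleGraphInclusive.Walk x y) (hw : w.IsPath)
    (hx : x ∈ Z) (hy : y ∈ Z) :
    ∃ r : OrientedSeq V w.length, IsZPath D Z r ∧ ∀ i, r.1 i ∈ w.support := by
  choose b hb using fun i : Fin w.length ↦ exists_adj_orient (w.adj_getVert_succ i.2)
  refine ⟨(fun i ↦ w.getVert i, b), ⟨?_, hb, ?_, ?_⟩, fun i ↦ w.getVert_mem_support i⟩
  · intro i j hij
    exact Fin.ext (hw.getVert_injOn (Nat.lt_succ_iff.1 i.2) (Nat.lt_succ_iff.1 j.2) hij)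
  · simpa using hx
  · simpa using hy

variable [DecidableEq V] {S S' : Finset V} {e z : ℕ}

/-- Inside `S` there are at least `e` directed edges of `D` and at least `z` vertices of `Z`. -/
def IsWitness (D : Digraph V) (Z : Set V) (S : Finset V) (e z : ℕ) : Prop :=
  ∃ (F : Finset (V × V)) (W : Finset V), F ⊆ S.offDiag ∧ (∀ a ∈ F, D.Adj a.1 a.2) ∧ F.card = e ∧
    W ⊆ S ∧ (∀ v ∈ W, v ∈ Z) ∧ W.card = z

/-- Adding a vertex together with edges joining it to `B ⊆ S`. The new edges differ from the old
ones because they meet the new vertex. -/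
theorem IsWitness.insert_edges (h : IsWitness D Z S e z) {u : V} (hu : u ∉ S) {B : Finset V}
    (hB : B ⊆ S) (hadj : ∀ w ∈ B, D.toSimpleGraphInclusive.Adj u w) :
    IsWitness D Z (insert u S) (e + B.card) z := by
  obtain ⟨F, W, hF, hFD, rfl, hW, hWZ, rfl⟩ := h
  have : ∀ w, ∃ b, w ∈ B → D.Adj (orient b u w).1 (orient b u w).2 := fun w ↦ by
    by_cases hw : w ∈ B
    · exact (exists_adj_orient (hadj w hw)).imp fun _ h _ ↦ h
    · exact ⟨true, fun h ↦ absurd h hw⟩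
  choose b hb using this
  have hmem : ∀ w ∈ B, orient (b w) u w ∉ F ∧ orient (b w) u w ∈ (insert u S).offDiag := by
    intro w hw
    have hw' := hB hw
    have hne : w ≠ u := fun h ↦ hu (h ▸ hw')
    constructor
    · intro h
      have := Finset.mem_offDiag.1 (hF h)
      cases hbw : b w <;> simp_all [orient]
    · cases hbw : b w <;> simp [orient, hw', hne, hne.symm]
  refine ⟨F ∪ B.image fun w ↦ orient (b w) u w, W, ?_, ?_, ?_,
    hW.trans (Finset.subset_insert _ _), hWZ, rfl⟩
  · refine Finset.union_subset (hF.trans (Finset.offDiag_mono (Finset.subset_insert _ _))) ?_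
    exact Finset.image_subset_iff.2 fun w hw ↦ (hmem w hw).2
  · intro a ha
    rcases Finset.mem_union.1 ha with ha | ha
    · exact hFD a ha
    · obtain ⟨w, hw, rfl⟩ := Finset.mem_image.1 ha
      exact hb w hw
  · rw [Finset.card_union_of_disjoint, Finset.card_image_of_injOn]
    · intro w hw w' hw' h
      have h1 : w ≠ u := fun h ↦ hu (h ▸ hB hw)
      have h2 : w' ≠ u := fun h ↦ hu (h ▸ hB hw')
      cases hbw : b w <;> cases hbw' : b w' <;> simp_all [orient]
    · refine Finset.disjoint_right.2 fun a ha ↦ ?_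
      obtain ⟨w, hw, rfl⟩ := Finset.mem_image.1 ha
      exact (hmem w hw).1

theorem IsWitness.insert_edges_mem (h : IsWitness D Z S e z) {u : V} (hu : u ∉ S) (huZ : u ∈ Z)
    {B : Finset V} (hB : B ⊆ S) (hadj : ∀ w ∈ B, D.toSimpleGraphInclusive.Adj u w) :
    IsWitness D Z (insert u S) (e + B.card) (z + 1) := by
  have hz : ∃ W ⊆ S, (∀ v ∈ W, v ∈ Z) ∧ W.card = z := by
    obtain ⟨F, W, hF, hFD, -, hW, hWZ, h⟩ := h
    exact ⟨W, hW, hWZ, h⟩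
  obtain ⟨W, hW, hWZ, rfl⟩ := hz
  obtain ⟨F, -, hF, hFD, hFe, -⟩ := h.insert_edges hu hB hadj
  refine ⟨F, insert u W, hF, hFD, hFe, Finset.insert_subset_insert _ hW, ?_,
    Finset.card_insert_of_notMem fun h ↦ hu (hW h)⟩
  intro v hv
  rcases Finset.mem_insert.1 hv with rfl | hv
  · exact huZ
  · exact hWZ v hv

/-- Attaching to `S` a path that starts in `S`, ends in `Z` and otherwise avoids `S`. -/
theorem IsWitness.attach_path {x y : V} (w : D.toSimpleGraphInclusive.Walk x y) (hw : w.IsPath)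
    (hl : 0 < w.length) (hx : x ∈ S) (hy : y ∈ Z) (hS : ∀ v ∈ w.support, v ≠ x → v ∉ S)
    (h : IsWitness D Z S e z) :
    ∃ S', S ⊆ S' ∧ (∀ v ∈ w.support, v ∈ S') ∧ S'.card = S.card + w.length ∧
      IsWitness D Z S' (e + w.length) (z + 1) := by
  induction w generalizing S e with
  | nil => simp at hl
  | @cons x x' y hadj p ih =>
    rw [SimpleGraph.Walk.cons_isPath_iff] at hw
    have hx'x : x' ≠ x := fun h ↦ hw.2 (h ▸ p.start_mem_support)
    have hx' : x' ∉ S := hS x' (by simp) hx'x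
    have hB : ({x} : Finset V) ⊆ S := by simpa
    have hadjB : ∀ v ∈ ({x} : Finset V), D.toSimpleGraphInclusive.Adj x' v := by
      simpa using hadj.symm
    by_cases hp : p.length = 0
    · obtain rfl := SimpleGraph.Walk.eq_of_length_eq_zero hp
      have hnil : p = SimpleGraph.Walk.nil := by simpa using hp
      subst hnil
      refine ⟨insert x' S, Finset.subset_insert _ _, ?_, ?_, ?_⟩
      · intro v hv
        simp only [SimpleGraph.Walk.support_cons, SimpleGraph.Walk.support_nil, List.mem_cons,
          List.not_mem_nil, or_false] at hv
        rcases hv with rfl | rfl <;> simp [hx]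
      · simp [Finset.card_insert_of_notMem hx']
      · simpa using h.insert_edges_mem hx' hy hB hadjB
    · obtain ⟨S', h1, h2, h3, h4⟩ := ih hw.1 (Nat.pos_of_ne_zero hp) (Finset.mem_insert_self x' S)
        hy (fun v hv hv' ↦ by
          rw [Finset.mem_insert, not_or]
          exact ⟨hv', hS v (by simp [hv]) (fun h ↦ hw.2 (h ▸ hv))⟩)
        (h.insert_edges hx' hB hadjB)
      have h5 := (Finset.subset_insert x' S).trans h1
      refine ⟨S', h5, ?_, ?_, ?_⟩
      · intro v hv
        rcases List.mem_cons.1 (SimpleGraph.Walk.support_cons hadj p ▸ hv) with rfl | hv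
        · exact h5 hx
        · exact h2 v hv
      · rw [h3, Finset.card_insert_of_notMem hx', SimpleGraph.Walk.length_cons]; ring
      · rw [SimpleGraph.Walk.length_cons]
        convert h4 using 1
        simp; ring

/-- Attaching to `S` a path with both ends in `S` and at least one inner vertex, the inner vertices
avoiding `S`. -/
theorem IsWitness.attach_ear {x y : V} (w : D.toSimpleGraphInclusive.Walk x y) (hw : w.IsPath)
    (hl : 2 ≤ w.length) (hx : x ∈ S) (hy : y ∈ S)
    (hS : ∀ v ∈ w.support, v ≠ x → v ≠ y → v ∉ S) (h : IsWitness D Z S e z) :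
    ∃ S', S ⊆ S' ∧ S'.card + 1 = S.card + w.length ∧ IsWitness D Z S' (e + w.length) z := by
  induction w generalizing S e with
  | nil => simp at hl
  | @cons x x' y hadj p ih =>
    rw [SimpleGraph.Walk.cons_isPath_iff] at hw
    rw [SimpleGraph.Walk.length_cons] at hl
    have hx'x : x' ≠ x := fun h ↦ hw.2 (h ▸ p.start_mem_support)
    have hxy : x ≠ y := fun h ↦ hw.2 (h ▸ p.end_mem_support)
    have hx'y : x' ≠ y := by
      rintro rfl
      have := SimpleGraph.Walk.length_eq_zero_iff.2 (SimpleGraph.Walk.isPath_iff_nil.1 hw.1)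
      lia
    have hx' : x' ∉ S := hS x' (by simp) hx'x hx'y
    by_cases hp : p.length = 1
    · refine ⟨insert x' S, Finset.subset_insert _ _, ?_, ?_⟩
      · simp [Finset.card_insert_of_notMem hx', hp]
      · have := h.insert_edges hx' (B := {x, y}) (by simp [Finset.insert_subset_iff, hx, hy]) (by
          simpa using ⟨hadj.symm, SimpleGraph.Walk.adj_of_length_eq_one hp⟩)
        rw [Finset.card_pair hxy] at this
        simpa [hp] using this
    · obtain ⟨S', h1, h3, h4⟩ := ih hw.1 (by lia) (Finset.mem_insert_self x' S)
        (Finset.mem_insert_of_mem hy) (fun v hv hv' hvy ↦ by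
          rw [Finset.mem_insert, not_or]
          exact ⟨hv', hS v (by simp [hv]) (fun h ↦ hw.2 (h ▸ hv)) hvy⟩)
        (h.insert_edges hx' (B := {x}) (by simpa) (by simpa using hadj.symm))
      refine ⟨S', (Finset.subset_insert x' S).trans h1, ?_, ?_⟩
      · rw [h3, Finset.card_insert_of_notMem hx', SimpleGraph.Walk.length_cons]; ring
      · rw [SimpleGraph.Walk.length_cons]
        convert h4 using 1
        simp; ring

/-- There are `k` pairwise disjoint paths of length `l` between vertices of `Z` inside `S`. -/
def HasZPaths (D : Digraph V) (Z : Set V) (S : Finset V) (l k : ℕ) : Prop :=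
  ∃ T : Finset (OrientedSeq V l), T.card = k ∧ (∀ r ∈ T, IsZPath D Z r ∧ ∀ i, r.1 i ∈ S) ∧
    (T : Set (OrientedSeq V l)).PairwiseDisjoint fun r ↦ Finset.univ.image r.1

theorem HasZPaths.mono {l k : ℕ} (h : HasZPaths D Z S l k) (hS : S ⊆ S') :
    HasZPaths D Z S' l k := by
  obtain ⟨T, h1, h2, h3⟩ := h
  exact ⟨T, h1, fun r hr ↦ ⟨(h2 r hr).1, fun i ↦ hS ((h2 r hr).2 i)⟩, h3⟩

theorem HasZPaths.succ {l k : ℕ} (h : HasZPaths D Z S l k) (hS : S ⊆ S') {r : OrientedSeq V l}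
    (hr : IsZPath D Z r) (hrS : ∀ i, r.1 i ∉ S) (hrS' : ∀ i, r.1 i ∈ S') :
    HasZPaths D Z S' l (k + 1) := by
  obtain ⟨T, rfl, h2, h3⟩ := h
  have hrT : r ∉ T := fun h ↦ hrS 0 ((h2 r h).2 0)
  refine ⟨insert r T, Finset.card_insert_of_notMem hrT, ?_, ?_⟩
  · intro r' hr'
    rcases Finset.mem_insert.1 hr' with rfl | hr'
    · exact ⟨hr, hrS'⟩
    · exact ⟨(h2 r' hr').1, fun i ↦ hS ((h2 r' hr').2 i)⟩
  · rw [Finset.coe_insert, Set.pairwiseDisjoint_insert]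
    refine ⟨h3, fun r' hr' _ ↦ ?_⟩
    refine Finset.disjoint_left.2 fun v hv hv' ↦ ?_
    obtain ⟨i, -, rfl⟩ := Finset.mem_image.1 hv
    obtain ⟨j, -, hj⟩ := Finset.mem_image.1 hv'
    exact hrS i (hj ▸ (h2 r' hr').2 j)

/-- What is known of a set `S` built up by successively adding short paths: it contains at least
`e` edges, at least `z` vertices of `Z`, and `k l` disjoint paths of length `l` between vertices of
`Z`. The first inequality says that the vertices of `S` not on these paths number at most four
times `2 (e - |S|) + z`. -/
def IsCluster (D : Digraph V) (Z : Set V) (S : Finset V) (e z : ℕ) (k : ℕ → ℕ) : Prop :=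
  IsWitness D Z S e z ∧ (∀ l ∈ Finset.Icc 1 4, HasZPaths D Z S l (k l)) ∧
    9 * S.card ≤ ∑ l ∈ Finset.Icc 1 4, (l + 1) * k l + 8 * e + 4 * z ∧
    S.card ≤ 2 * e ∧ e ≤ 2 * S.card

theorem isCluster_empty : IsCluster D Z ∅ 0 0 0 :=
  ⟨⟨∅, ∅, by simp⟩, fun l _ ↦ ⟨∅, by simp⟩, by simp⟩

/-- A cluster left by a short path between two vertices of `S ∪ Z` can be enlarged. -/
theorem IsCluster.exists_larger {k : ℕ → ℕ} (h : IsCluster D Z S e z k) {x y : V}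
    (hx : x ∈ (S : Set V) ∪ Z) (hy : y ∈ (S : Set V) ∪ Z) (hxy : x ≠ y)
    (w : D.toSimpleGraphInclusive.Walk x y) (hw : w.IsPath) (hl : w.length ≤ 4) {v : V}
    (hv : v ∈ w.support) (hvS : v ∉ S) :
    ∃ S' e' z' k', IsCluster D Z S' e' z' k' ∧ S.card < S'.card ∧ S'.card ≤ S.card + 5 := by
  obtain ⟨x, hx, y, hy, hxy, w, hw, hl', ⟨v, hv, hvS⟩, hin⟩ :=
    SimpleGraph.exists_isPath_inner_notMem hx hy hxy w hw hv hvS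
  replace hl := hl'.trans hl
  clear hl'
  obtain ⟨hwit, hpaths, h1, h2, h3⟩ := h
  simp only [Finset.mem_coe] at hin hvS
  have hpos : 0 < w.length :=
    Nat.pos_of_ne_zero fun h0 ↦ hxy (SimpleGraph.Walk.eq_of_length_eq_zero h0)
  -- The case of exactly one end in `S`: `2 (e - |S|) + z` grows by one.
  have hone : ∀ {x y : V} (w : D.toSimpleGraphInclusive.Walk x y), w.IsPath → 0 < w.length →
      w.length ≤ 4 → x ∈ S → y ∉ S → y ∈ Z →
      (∀ u ∈ w.support, u ≠ x → u ≠ y → u ∉ S) →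
      ∃ S' e' z' k', IsCluster D Z S' e' z' k' ∧ S.card < S'.card ∧ S'.card ≤ S.card + 5 := by
    intro x y w hw hpos hl hxS hyS hyZ hin
    obtain ⟨S', hSS', -, hc, hw'⟩ := hwit.attach_path w hw hpos hxS hyZ
      (fun u hu hux huS ↦ hin u hu hux (fun h ↦ hyS (h ▸ huS)) huS)
    exact ⟨S', _, _, k, ⟨hw', fun l hl ↦ (hpaths l hl).mono hSS', by lia, by lia, by lia⟩,
      by lia, by lia⟩
  by_cases hxS : x ∈ S
  · by_cases hyS : y ∈ S
    · -- Both ends lie in `S`: one more edge than vertices is added, and `2 (e - |S|) + z` grows by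
      -- two.
      have hl2 : 2 ≤ w.length := by
        by_contra hlt
        have h1 : w.length = 1 := by lia
        cases w with
        | nil => simp at hpos
        | cons hadj p =>
          have hp : p.length = 0 := by simpa using h1
          obtain rfl := SimpleGraph.Walk.eq_of_length_eq_zero hp
          have hnil : p = SimpleGraph.Walk.nil := by simpa using hp
          subst hnil
          simp only [SimpleGraph.Walk.support_cons, SimpleGraph.Walk.support_nil, List.mem_cons,
            List.not_mem_nil, or_false] at hv
          rcases hv with rfl | rfl <;> contradiction
      obtain ⟨S', hSS', hc, hw'⟩ := hwit.attach_ear w hw hl2 hxS hyS hin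
      exact ⟨S', _, _, k, ⟨hw', fun l hl ↦ (hpaths l hl).mono hSS', by lia, by lia, by lia⟩,
        by lia, by lia⟩
    · exact hone w hw hpos hl hxS hyS (hy.resolve_left hyS) hin
  · by_cases hyS : y ∈ S
    · exact hone w.reverse hw.reverse (by simpa) (by simpa) hyS hxS (hx.resolve_left hxS)
        (fun u hu h h' ↦ hin u (by simpa using hu) h' h)
    · -- No end lies in `S`: the path is a new component, `2 (e - |S|) + z` is unchanged, and the
      -- vertices are paid for by recording the path in the family of disjoint paths.
      have hxZ : x ∈ Z := hx.resolve_left hxS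
      have hyZ : y ∈ Z := hy.resolve_left hyS
      have hout : ∀ u ∈ w.support, u ∉ S := fun u hu huS ↦
        hin u hu (fun h ↦ hxS (h ▸ huS)) (fun h ↦ hyS (h ▸ huS)) huS
      have hwit' := hwit.insert_edges_mem hxS hxZ (B := ∅) (by simp) (by simp)
      obtain ⟨S', hSS', hsupp, hc, hw'⟩ := hwit'.attach_path w hw hpos (Finset.mem_insert_self _ _)
        hyZ (fun u hu hux ↦ by
          rw [Finset.mem_insert, not_or]
          exact ⟨hux, hout u hu⟩)
      have hSS'' := (Finset.subset_insert x S).trans hSS'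
      obtain ⟨r, hr, hrw⟩ := exists_isZPath w hw hxZ hyZ
      rw [Finset.card_insert_of_notMem hxS] at hc
      have hmem : w.length ∈ Finset.Icc 1 4 := Finset.mem_Icc.2 ⟨hpos, hl⟩
      refine ⟨S', _, _, Function.update k w.length (k w.length + 1),
        ⟨hw', fun l hl ↦ ?_, ?_, by simp; lia, by simp; lia⟩, by lia, by lia⟩
      · rcases eq_or_ne l w.length with rfl | hne
        · rw [Function.update_self]
          exact (hpaths _ hl).succ hSS'' hr (fun i ↦ hout _ (hrw i)) (fun i ↦ hsupp _ (hrw i))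
        · rw [Function.update_of_ne hne]
          exact (hpaths l hl).mono hSS''
      · have hsum : ∑ l ∈ Finset.Icc 1 4, (l + 1) * Function.update k w.length (k w.length + 1) l =
            ∑ l ∈ Finset.Icc 1 4, (l + 1) * k l + (w.length + 1) := by
          rw [← Finset.add_sum_erase _ _ hmem, ← Finset.add_sum_erase _ (fun l ↦ (l + 1) * k l) hmem,
            Function.update_self, Finset.sum_congr rfl fun l hl ↦ by
              rw [Function.update_of_ne (Finset.ne_of_mem_erase hl)]]
          ring
        rw [hsum]
        simp only [Finset.card_empty]
        lia

/-- If the filtering process produces more than `m` vertices, then some cluster has between `m + 1`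
and `m + 5` vertices. -/
theorem exists_isCluster_of_lt_ncard [Finite V] {m : ℕ}
    (hm : m < (D.toSimpleGraphInclusive.filterSet Z).ncard) :
    ∃ S e z k, IsCluster D Z S e z k ∧ m < S.card ∧ S.card ≤ m + 5 := by
  classical
  have := Fintype.ofFinite V
  by_contra! hno
  have hgrow : ∀ j : ℕ, ∃ S e z k, IsCluster D Z S e z k ∧ j ≤ S.card ∧ S.card ≤ m := by
    intro j
    induction j with
    | zero => exact ⟨∅, 0, 0, 0, isCluster_empty, by simp⟩
    | succ j ih =>
      obtain ⟨S, e, z, k, hS, hj, hSm⟩ := ih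
      have : ¬ D.toSimpleGraphInclusive.filterSet Z ⊆ S := fun h ↦ by
        have := Set.ncard_le_ncard h (Set.toFinite _)
        rw [Set.ncard_coe_finset] at this
        lia
      have hex := mt SimpleGraph.filterSet_subset this
      push Not at hex
      obtain ⟨x, hx, y, hy, hxy, w, hw, hl, v, hv, hvS⟩ := hex
      obtain ⟨S', e', z', k', hS', h1, h2⟩ := hS.exists_larger hx hy hxy w hw hl hv hvS
      refine ⟨S', e', z', k', hS', by lia, ?_⟩
      by_contra hlt
      have := hno S' e' z' k' hS' (by lia)
      lia
  obtain ⟨S, e, z, k, -, h1, h2⟩ := hgrow (m + 1)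
  lia

end Digraph

/-! ### First moment bounds -/

namespace Digraph

variable {V : Type*} [DecidableEq V]

theorem HasZPaths.of_le {D : Digraph V} {Z : Set V} {S : Finset V} {l k r : ℕ}
    (h : HasZPaths D Z S l k) (hr : r ≤ k) : HasZPaths D Z S l r := by
  obtain ⟨T, rfl, h2, h3⟩ := h
  obtain ⟨T', hT', rfl⟩ := Finset.exists_subset_card_eq hr
  exact ⟨T', rfl, fun r hr ↦ h2 r (hT' hr), h3.subset hT'⟩

theorem OrientedSeq.edge_mem_offDiag {l : ℕ} {r : OrientedSeq V l} (hr : Function.Injective r.1)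
    (i : Fin l) : r.edge i ∈ (Finset.univ.image r.1).offDiag := by
  have : r.1 i.castSucc ≠ r.1 i.succ := fun h ↦ by simpa [Fin.ext_iff] using hr h
  unfold edge orient
  split_ifs <;> simp [this, this.symm]

variable [Fintype V] (μ : Measure (Digraph V)) [IsProbabilityMeasure μ] {p Q : ℝ} {K d : ℕ}

/-- First moment bound for families of `r` disjoint paths of length `l` between vertices of small
degree. -/
theorem real_hasZPaths_le (hp : 0 ≤ p)
    (H : ∀ (S W : Finset V) (F : Finset (V × V)), S.card ≤ K → W ⊆ S → F ⊆ S.offDiag →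
      μ.real {D | (∀ e ∈ F, D.Adj e.1 e.2) ∧ ∀ v ∈ W, D.minDeg v ≤ d} ≤ p ^ F.card * Q ^ W.card)
    {l r : ℕ} (hl : 0 < l) (hr : (l + 1) * r ≤ K) :
    μ.real {D | HasZPaths D {v | D.minDeg v ≤ d} Finset.univ l r} ≤
      (Fintype.card V ^ (l + 1) * 2 ^ l * p ^ l * Q ^ 2) ^ r / r.factorial := by
  classical
  -- The families `T` that can occur; the factor `1 / r !` comes from counting unordered families.
  set 𝒯 : Finset (Finset (OrientedSeq V l)) := {T ∈ Finset.univ.powersetCard r |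
    (∀ r ∈ T, Function.Injective r.1) ∧
      (T : Set (OrientedSeq V l)).PairwiseDisjoint fun r ↦ Finset.univ.image r.1} with h𝒯
  let A : Finset (OrientedSeq V l) → Set (Digraph V) := fun T ↦
    {D | (∀ e ∈ T.biUnion fun r ↦ Finset.univ.image r.edge, D.Adj e.1 e.2) ∧
      ∀ v ∈ T.biUnion fun r ↦ {r.1 0, r.1 (Fin.last l)}, D.minDeg v ≤ d}
  have hcover : {D : Digraph V | HasZPaths D {v | D.minDeg v ≤ d} Finset.univ l r} ⊆
      ⋃ T ∈ 𝒯, A T := by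
    rintro D ⟨T, hT, h1, h2⟩
    refine Set.mem_biUnion (x := T) ?_ ⟨?_, ?_⟩
    · simp only [h𝒯, Finset.coe_filter, Set.mem_ofPred_eq, Finset.mem_powersetCard]
      exact ⟨⟨Finset.subset_univ _, hT⟩, fun r hr ↦ (h1 r hr).1.1, h2⟩
    · intro e he
      obtain ⟨r, hr, he⟩ := Finset.mem_biUnion.1 he
      obtain ⟨i, -, rfl⟩ := Finset.mem_image.1 he
      exact (h1 r hr).1.2.1 i
    · intro v hv
      obtain ⟨r, hr, hv⟩ := Finset.mem_biUnion.1 hv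
      rcases Finset.mem_insert.1 hv with rfl | hv
      · exact (h1 r hr).1.2.2.1
      · obtain rfl := Finset.mem_singleton.1 hv
        exact (h1 r hr).1.2.2.2
  have hA : ∀ T ∈ 𝒯, μ.real (A T) ≤ (p ^ l * Q ^ 2) ^ r := by
    intro T hT
    simp only [h𝒯, Finset.mem_filter, Finset.mem_powersetCard] at hT
    obtain ⟨⟨-, rfl⟩, hinj, hdisj⟩ := hT
    have hends : ∀ r : OrientedSeq V l, ({r.1 0, r.1 (Fin.last l)} : Finset V) ⊆
        Finset.univ.image r.1 := fun r ↦ by simp [Finset.insert_subset_iff]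
    have hsub : ∀ r ∈ T, Finset.univ.image r.1 ⊆ T.biUnion fun r ↦ Finset.univ.image r.1 :=
      fun r hr ↦ Finset.subset_biUnion_of_mem (fun r : OrientedSeq V l ↦ Finset.univ.image r.1) hr
    refine (H (T.biUnion fun r ↦ Finset.univ.image r.1) _ _ ?_ ?_ ?_).trans_eq ?_
    · refine le_trans Finset.card_biUnion_le (le_trans (Finset.sum_le_card_nsmul _ _ (l + 1) ?_) ?_)
      · exact fun r _ ↦ Finset.card_image_le.trans_eq (by simp)
      · simpa [mul_comm] using hr
    · exact Finset.biUnion_subset.2 fun r hr ↦ (hends r).trans (hsub r hr)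
    · refine Finset.biUnion_subset.2 fun r hr ↦ Finset.image_subset_iff.2 fun i _ ↦ ?_
      exact Finset.offDiag_mono (hsub r hr) (OrientedSeq.edge_mem_offDiag (hinj r hr) i)
    · rw [Finset.card_biUnion, Finset.card_biUnion, mul_pow, ← pow_mul, ← pow_mul]
      · congr 2
        · rw [Finset.sum_congr rfl fun r hr ↦ by
            rw [Finset.card_image_of_injective _ (OrientedSeq.edge_injective (hinj r hr))]]
          simp [mul_comm]
        · rw [Finset.sum_congr rfl fun r hr ↦ by
            rw [Finset.card_pair fun h ↦ hl.ne (by simpa using congrArg Fin.val (hinj r hr h))]]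
          simp [mul_comm]
      · exact fun r hr r' hr' hne ↦ (hdisj hr hr' hne).mono (hends r) (hends r')
      · intro r hr r' hr' hne
        refine Finset.disjoint_left.2 fun e he he' ↦ ?_
        obtain ⟨i, -, rfl⟩ := Finset.mem_image.1 he
        obtain ⟨j, -, hj⟩ := Finset.mem_image.1 he'
        have h1 := (Finset.mem_offDiag.1 (OrientedSeq.edge_mem_offDiag (hinj r hr) i)).1
        have h2 := (Finset.mem_offDiag.1 (OrientedSeq.edge_mem_offDiag (hinj r' hr') j)).1
        rw [hj] at h2
        exact Finset.disjoint_left.1 (hdisj hr hr' hne) h1 h2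
  have hcard : (𝒯.card : ℝ) ≤ (Fintype.card V ^ (l + 1) * 2 ^ l) ^ r / r.factorial := by
    have h1 : 𝒯.card ≤ (Fintype.card V ^ (l + 1) * 2 ^ l).choose r := by
      refine (Finset.card_filter_le _ _).trans_eq ?_
      rw [Finset.card_powersetCard]
      simp
    refine le_trans (Nat.cast_le.2 h1) ((Nat.choose_le_pow_div _ _).trans_eq ?_)
    push_cast
    rfl
  calc _ ≤ μ.real (⋃ T ∈ 𝒯, A T) := measureReal_mono hcover (measure_ne_top _ _)
    _ ≤ ∑ T ∈ 𝒯, μ.real (A T) := measureReal_biUnion_finset_le _ _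
    _ ≤ 𝒯.card • (p ^ l * Q ^ 2) ^ r := Finset.sum_le_card_nsmul _ _ _ hA
    _ ≤ (Fintype.card V ^ (l + 1) * 2 ^ l) ^ r / r.factorial * (p ^ l * Q ^ 2) ^ r := by
        rw [nsmul_eq_mul]
        gcongr
    _ = _ := by ring

/-- First moment bound for sets of `s` vertices containing many edges and many vertices of small
degree. -/
theorem real_exists_isWitness_le (hp : 0 ≤ p) (hQ : 0 ≤ Q)
    (H : ∀ (S W : Finset V) (F : Finset (V × V)), S.card ≤ K → W ⊆ S → F ⊆ S.offDiag →
      μ.real {D | (∀ e ∈ F, D.Adj e.1 e.2) ∧ ∀ v ∈ W, D.minDeg v ≤ d} ≤ p ^ F.card * Q ^ W.card)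
    {s e z : ℕ} (hs : s ≤ K) :
    μ.real {D | ∃ S, S.card = s ∧ IsWitness D {v | D.minDeg v ≤ d} S e z} ≤
      (Fintype.card V).choose s * (s ^ 2).choose e * 2 ^ s * p ^ e * Q ^ z := by
  classical
  let I : Finset (Σ _ : Finset V, Finset (V × V) × Finset V) :=
    ((Finset.univ : Finset V).powersetCard s).sigma fun S ↦
      (S ×ˢ S).powersetCard e ×ˢ S.powerset
  let J := {i ∈ I | i.2.1 ⊆ i.1.offDiag ∧ i.2.2.card = z}
  let A : (Σ _ : Finset V, Finset (V × V) × Finset V) → Set (Digraph V) := fun i ↦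
    {D | (∀ a ∈ i.2.1, D.Adj a.1 a.2) ∧ ∀ v ∈ i.2.2, D.minDeg v ≤ d}
  have hcover : {D : Digraph V | ∃ S, S.card = s ∧ IsWitness D {v | D.minDeg v ≤ d} S e z} ⊆
      ⋃ i ∈ J, A i := by
    rintro D ⟨S, hS, F, W, hF, hFD, hFe, hW, hWZ, hWz⟩
    refine Set.mem_biUnion (x := ⟨S, F, W⟩) ?_ ⟨hFD, hWZ⟩
    have hF' : F ⊆ S ×ˢ S := fun a ha ↦
      Finset.mem_product.2 ⟨(Finset.mem_offDiag.1 (hF ha)).1, (Finset.mem_offDiag.1 (hF ha)).2.1⟩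
    simp [J, I, hS, hF, hFe, hW, hWz, hF']
  have hA : ∀ i ∈ J, μ.real (A i) ≤ p ^ e * Q ^ z := by
    rintro ⟨S, F, W⟩ hi
    simp only [J, I, Finset.mem_filter, Finset.mem_sigma, Finset.mem_powersetCard,
      Finset.mem_product, Finset.mem_powerset] at hi
    obtain ⟨⟨⟨-, hS⟩, ⟨-, rfl⟩, hW⟩, hF, rfl⟩ := hi
    exact H S W F (hS.trans_le hs) hW hF
  have hcard : J.card ≤ (Fintype.card V).choose s * ((s ^ 2).choose e * 2 ^ s) := by
    refine (Finset.card_filter_le _ _).trans ?_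
    rw [Finset.card_sigma]
    refine (Finset.sum_le_card_nsmul _ _ ((s ^ 2).choose e * 2 ^ s) fun S hS ↦ ?_).trans_eq ?_
    · rw [Finset.card_product, Finset.card_powersetCard, Finset.card_product,
        Finset.card_powerset, (Finset.mem_powersetCard.1 hS).2, sq]
    · simp
  calc _ ≤ μ.real (⋃ i ∈ J, A i) := measureReal_mono hcover (measure_ne_top _ _)
    _ ≤ ∑ i ∈ J, μ.real (A i) := measureReal_biUnion_finset_le _ _
    _ ≤ J.card • (p ^ e * Q ^ z) := Finset.sum_le_card_nsmul _ _ _ hA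
    _ ≤ ((Fintype.card V).choose s * ((s ^ 2).choose e * 2 ^ s) : ℕ) * (p ^ e * Q ^ z) := by
        rw [nsmul_eq_mul]
        gcongr
    _ = _ := by push_cast; ring

end Digraph

/-! ### Numerical bounds for large `c` -/

theorem pow_div_factorial_le_three_pow {x : ℝ} (r : ℕ) (hx : 0 ≤ x) :
    (x * r) ^ r / r.factorial ≤ (3 * x) ^ r := by
  have h1 : (r : ℝ) ^ r / r.factorial ≤ 3 ^ r := by
    refine (Real.pow_div_factorial_le_exp _ r.cast_nonneg r).trans ?_
    rw [← mul_one (r : ℝ), Real.exp_nat_mul]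
    gcongr
    exact Real.exp_one_lt_three.le
  calc (x * r) ^ r / r.factorial = x ^ r * ((r : ℝ) ^ r / r.factorial) := by
        rw [mul_pow, mul_div_assoc]
    _ ≤ x ^ r * 3 ^ r := by gcongr
    _ = _ := by rw [← mul_pow, mul_comm]

/-- The probability of having at most three successes in `m` trials, if the expected number of
successes is almost `c`. -/
theorem sum_powerset_card_le_three_le {V : Type*} (M : Finset V) {c p : ℝ} (hc : 20 ≤ c)
    (hp : 0 ≤ p) (hp1 : p ≤ 1) (hM : M.card * p ≤ c) (hM' : c - 1 / 10 ≤ (M.card - 3 : ℝ) * p) :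
    2 * ∑ A ∈ M.powerset with A.card ≤ 3, p ^ A.card * (1 - p) ^ (M.card - A.card) ≤
      c ^ 3 * Real.exp (-c) / 2 := by
  classical
  set m := M.card with hm
  have hunion : {A ∈ M.powerset | A.card ≤ 3} =
      (Finset.range 4).biUnion fun j ↦ M.powersetCard j := by
    ext A
    simp only [Finset.mem_filter, Finset.mem_powerset, Finset.mem_biUnion, Finset.mem_range,
      Finset.mem_powersetCard]
    constructor
    · exact fun h ↦ ⟨A.card, by lia, h.1, rfl⟩
    · rintro ⟨j, hj, h, rfl⟩
      exact ⟨h, by lia⟩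
  have hterm : ∀ j ∈ Finset.range 4,
      ∑ A ∈ M.powersetCard j, p ^ A.card * (1 - p) ^ (m - A.card) ≤
        c ^ j / j.factorial * (Real.exp (-c) * (10 / 9)) := by
    intro j hj
    have hj' : j ≤ 3 := by simpa [Nat.lt_succ_iff] using hj
    rw [Finset.sum_congr rfl fun A hA ↦ by rw [(Finset.mem_powersetCard.1 hA).2],
      Finset.sum_const, Finset.card_powersetCard, nsmul_eq_mul, ← mul_assoc]
    have h1 : (m.choose j : ℝ) * p ^ j ≤ c ^ j / j.factorial := by
      calc (m.choose j : ℝ) * p ^ j ≤ (m : ℝ) ^ j / j.factorial * p ^ j := by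
            gcongr
            exact Nat.choose_le_pow_div _ _
        _ = (m * p) ^ j / j.factorial := by ring
        _ ≤ _ := by gcongr
    have h2 : (1 - p) ^ (m - j) ≤ Real.exp (-c) * (10 / 9) := by
      calc (1 - p) ^ (m - j) ≤ Real.exp (-p) ^ (m - j) := by
            exact pow_le_pow_left₀ (by linarith) (Real.one_sub_le_exp_neg p) _
        _ = Real.exp ((m - j : ℕ) * (-p)) := by rw [Real.exp_nat_mul]
        _ ≤ Real.exp (-c + 1 / 10) := by
            gcongr
            have h3 : (m : ℝ) - 3 ≤ ((m - j : ℕ) : ℝ) := by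
              have : (m : ℝ) ≤ ((m - j : ℕ) : ℝ) + 3 := by exact_mod_cast (by lia)
              linarith
            nlinarith
        _ = Real.exp (-c) * Real.exp (1 / 10) := Real.exp_add _ _
        _ ≤ _ := by
            gcongr
            have := Real.one_sub_le_exp_neg (1 / 10)
            rw [Real.exp_neg, le_inv_comm₀ (by norm_num) (Real.exp_pos _)] at this
            exact this.trans_eq (by norm_num)
    have h4 : 0 ≤ 1 - p := by linarith
    gcongr
  rw [hunion, Finset.sum_biUnion]
  · have := Finset.sum_le_sum hterm
    rw [← Finset.sum_mul] at this
    have h5 : ∑ j ∈ Finset.range 4, c ^ j / j.factorial ≤ c ^ 3 / 5 := by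
      simp only [Finset.sum_range_succ, Finset.sum_range_zero, Nat.factorial]
      norm_num
      nlinarith [mul_nonneg (mul_nonneg (sub_nonneg.2 hc) (sub_nonneg.2 hc)) (sub_nonneg.2 hc),
        mul_nonneg (sub_nonneg.2 hc) (sub_nonneg.2 hc)]
    calc _ ≤ 2 * (c ^ 3 / 5 * (Real.exp (-c) * (10 / 9))) := by
          gcongr
          exact this.trans (by gcongr)
      _ ≤ _ := by
          have : 0 ≤ c ^ 3 * Real.exp (-c) := by positivity
          linarith
  · intro i _ j _ hij
    exact Finset.pairwise_disjoint_powersetCard M hij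

namespace Digraph

/-- In `𝒟(n, c / n)` and for sets of at most a small multiple of `n / c` vertices, each edge costs
`c / n` and each vertex of small degree costs `c ^ 3 * exp (-c) / 2`. -/
theorem binomialRandom_real_edges_minDeg_le_of_card_le {n : ℕ} {c : ℝ} (hc : 20 ≤ c)
    (hcn : c ≤ n) {S W : Finset (Fin n)} {F : Finset (Fin n × Fin n)}
    (hS : c * (S.card + 3) ≤ n / 10) (hW : W ⊆ S) (hF : F ⊆ S.offDiag) :
    (binomialRandom (Fin n) (Set.projIcc (0 : ℝ) 1 zero_le_one (c / n))).real
      {D | (∀ e ∈ F, D.Adj e.1 e.2) ∧ ∀ v ∈ W, D.minDeg v ≤ 3} ≤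
      (c / n) ^ F.card * (c ^ 3 * Real.exp (-c) / 2) ^ W.card := by
  have hn : (0 : ℝ) < n := by linarith
  have hp : 0 ≤ c / n := by positivity
  have hp1 : c / n ≤ 1 := (div_le_one hn).2 hcn
  refine (binomialRandom_real_edges_minDeg_le _ S W F hW hF 3).trans ?_
  rw [Set.projIcc_of_mem zero_le_one ⟨hp, hp1⟩]
  have hcard : (Sᶜ.card : ℝ) = n - S.card := by
    rw [Finset.card_compl, Fintype.card_fin, Nat.cast_sub (by simpa using S.card_le_univ)]
  have h1 : 0 ≤ 1 - c / n := by linarith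
  gcongr ?_ * ?_ ^ _
  refine sum_powerset_card_le_three_le _ hc hp hp1 ?_ ?_
  · rw [hcard]
    calc ((n : ℝ) - S.card) * (c / n) ≤ n * (c / n) := by
          gcongr
          linarith [S.card.cast_nonneg (α := ℝ)]
      _ = c := by field_simp
  · rw [hcard]
    have : ((n : ℝ) - S.card - 3) * (c / n) = c - c * (S.card + 3) / n := by
      field_simp
      ring
    rw [this]
    have : c * (S.card + 3) / n ≤ 1 / 10 := by
      rw [div_le_iff₀ hn]
      linarith
    linarith

end Digraph

/-- The first moment bound for disjoint paths of length at most four is exponentially small. -/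
theorem zPaths_bound {c N : ℝ} {l r : ℕ} (hc : 1 ≤ c) (hN : 0 < N) (hl : l ≤ 4)
    (hr : (2 * c) ^ 10 * Real.exp (-2 * c) * N / 20 ≤ r) :
    (N ^ (l + 1) * 2 ^ l * (c / N) ^ l * (c ^ 3 * Real.exp (-c) / 2) ^ 2) ^ r / r.factorial ≤
      (1 / 4) ^ r := by
  have h1 : N ^ (l + 1) * 2 ^ l * (c / N) ^ l * (c ^ 3 * Real.exp (-c) / 2) ^ 2 ≤ 5 / 64 * r := by
    have h2 : N ^ (l + 1) * 2 ^ l * (c / N) ^ l = N * (2 * c) ^ l := by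
      rw [div_pow, mul_pow]
      field_simp
      ring
    have h3 : Real.exp (-2 * c) = Real.exp (-c) ^ 2 := by
      rw [← Real.exp_nat_mul]
      congr 1
      push_cast
      ring
    calc _ ≤ N * (2 * c) ^ 4 * (c ^ 3 * Real.exp (-c) / 2) ^ 2 := by
          rw [h2]
          gcongr
          linarith
      _ = 5 / 64 * ((2 * c) ^ 10 * Real.exp (-2 * c) * N / 20) := by
          rw [h3]
          ring
      _ ≤ _ := by gcongr
  calc _ ≤ (5 / 64 * (r : ℝ)) ^ r / r.factorial := by gcongr
    _ ≤ (3 * (5 / 64)) ^ r := pow_div_factorial_le_three_pow r (by norm_num)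
    _ ≤ _ := by gcongr; norm_num

/-- The first moment bound for dense sets of `s` vertices is exponentially small. Here `x = s / N`
is of order `Q ^ 2`, up to a polynomial in `c`, and `q` is the twentieth root of `Q`. -/
theorem witness_bound {c q : ℝ} {N s e z : ℕ} (hc : 1 ≤ c) (hN : 0 < N) (hs : 0 < s)
    (hq : 0 < q) (hqQ : q ^ 20 = c ^ 3 * Real.exp (-c) / 2)
    (hqc : q * (216 * 8192 * c ^ 6) ≤ 1 / 2)
    (hs1 : (2 * c) ^ 10 * Real.exp (-2 * c) * N ≤ s)
    (hs2 : s ≤ 2 * ((2 * c) ^ 10 * Real.exp (-2 * c) * N))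
    (hse : s ≤ 2 * e) (hes : e ≤ 2 * s) (hez : 41 * s ≤ 40 * e + 20 * z) :
    (N.choose s * (s ^ 2).choose e * 2 ^ s * (c / N) ^ e * (c ^ 3 * Real.exp (-c) / 2) ^ z : ℝ) ≤
      (1 / 2) ^ s := by
  have hs0 : (0 : ℝ) < s := by exact_mod_cast hs
  have hN0 : (0 : ℝ) < N := by exact_mod_cast hN
  have hc0 : 0 < c := by linarith
  have hq1 : q ≤ 1 := by
    have : 1 ≤ 216 * 8192 * c ^ 6 := by linarith [one_le_pow₀ hc (n := 6)]
    nlinarith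
  have hexp : (2 * c) ^ 10 * Real.exp (-2 * c) = 4096 * c ^ 4 * q ^ 40 := by
    have h3 : Real.exp (-2 * c) = Real.exp (-c) ^ 2 := by
      rw [← Real.exp_nat_mul]
      congr 1
      push_cast
      ring
    rw [show q ^ 40 = (q ^ 20) ^ 2 by ring, hqQ, h3]
    ring
  rw [hexp] at hs1 hs2
  -- The hypotheses on `s` say that `s / N = y * Q ^ 2` with `1 ≤ y ≤ 8192 * c ^ 4`.
  obtain ⟨y, hy⟩ : ∃ y : ℝ, (s : ℝ) / N = y * q ^ 40 := ⟨s / N / q ^ 40, by field_simp⟩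
  have hsy : (s : ℝ) = y * q ^ 40 * N := by rw [← hy]; field_simp
  have hqN : 0 < q ^ 40 * N := by positivity
  have hc4 : 1 ≤ c ^ 4 := one_le_pow₀ hc
  have hy1 : 1 ≤ y := by
    rw [hsy] at hs1
    have : 4096 * c ^ 4 * (q ^ 40 * N) ≤ y * (q ^ 40 * N) := by linarith
    linarith [le_of_mul_le_mul_right this hqN]
  have hy2 : y ≤ 8192 * c ^ 4 := by
    rw [hsy] at hs2
    have : y * (q ^ 40 * N) ≤ 8192 * c ^ 4 * (q ^ 40 * N) := by linarith
    exact le_of_mul_le_mul_right this hqN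
  have hchoose1 : (N.choose s : ℝ) ≤ (3 * (N / s)) ^ s := by
    refine (Nat.choose_le_pow_div _ _).trans ?_
    have := pow_div_factorial_le_three_pow s (x := (N : ℝ) / s) (by positivity)
    rwa [div_mul_cancel₀ _ hs0.ne'] at this
  have he0 : (0 : ℝ) < e := by exact_mod_cast (by lia : 0 < e)
  have hchoose2 : ((s ^ 2).choose e : ℝ) ≤ (6 * s) ^ e := by
    refine (Nat.choose_le_pow_div _ _).trans ?_
    have := pow_div_factorial_le_three_pow e (x := (s : ℝ) ^ 2 / e) (by positivity)
    rw [div_mul_cancel₀ _ he0.ne'] at this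
    push_cast
    refine this.trans ?_
    refine pow_le_pow_left₀ (by positivity) ?_ e
    rw [← mul_div_assoc, div_le_iff₀ he0]
    have : (s : ℝ) ≤ 2 * e := by exact_mod_cast hse
    nlinarith
  -- Here `2 (e - s) + z ≥ s / 20` leaves a factor `Q ^ (s / 20) = q ^ s`.
  have hyq : (s / N : ℝ) ^ e * (q ^ 20) ^ z ≤ (8192 * c ^ 4) ^ s * (s / N : ℝ) ^ s * q ^ s := by
    rw [hy]
    calc (y * q ^ 40) ^ e * (q ^ 20) ^ z = y ^ e * q ^ (40 * e + 20 * z) := by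
          rw [mul_pow, ← pow_mul, ← pow_mul, pow_add]
          ring
      _ ≤ y ^ (2 * s) * q ^ (41 * s) :=
          mul_le_mul (pow_le_pow_right₀ hy1 hes) (pow_le_pow_of_le_one hq.le hq1 hez)
            (by positivity) (by positivity)
      _ = y ^ s * (y * q ^ 40) ^ s * q ^ s := by
          rw [mul_pow, ← pow_mul, show 41 * s = 40 * s + s by ring, pow_add,
            show 2 * s = s + s by ring, pow_add]
          ring
      _ ≤ _ := by gcongr
  rw [← hqQ]
  calc _ ≤ (3 * (N / s : ℝ)) ^ s * (6 * s) ^ e * 2 ^ s * (c / N) ^ e * (q ^ 20) ^ z := by gcongr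
    _ = 6 ^ s * (N / s : ℝ) ^ s * (6 * c) ^ e * ((s / N : ℝ) ^ e * (q ^ 20) ^ z) := by
        rw [show (6 : ℝ) ^ s = 3 ^ s * 2 ^ s by rw [← mul_pow]; norm_num]
        simp only [mul_pow, div_pow]
        field_simp
    _ ≤ 6 ^ s * (N / s : ℝ) ^ s * (6 * c) ^ (2 * s) *
          ((8192 * c ^ 4) ^ s * (s / N : ℝ) ^ s * q ^ s) := by
        gcongr
        linarith
    _ = (q * (216 * 8192 * c ^ 6)) ^ s * (N / s * (s / N) : ℝ) ^ s := by
        rw [pow_mul]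
        simp only [← mul_pow]
        congr 1
        ring
    _ = (q * (216 * 8192 * c ^ 6)) ^ s := by
        rw [div_mul_div_cancel₀ hs0.ne', div_self hN0.ne', one_pow, mul_one]
    _ ≤ _ := by gcongr

theorem eventually_pow_mul_exp_neg_le (k : ℕ) {δ : ℝ} (hδ : 0 < δ) :
    ∀ᶠ c : ℝ in atTop, c ^ k * Real.exp (-c) ≤ δ :=
  (Real.tendsto_pow_mul_exp_neg_atTop_nhds_zero k).eventually (eventually_le_nhds hδ)

/-! ### The size of the filtered set -/

/-- The largeness of `c` that the argument needs: the target density is much smaller than `1 / c`,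
and the twentieth root of the bound for the probability of a small degree beats any fixed
polynomial. -/
theorem eventually_parameters :
    ∀ᶠ c : ℝ in atTop, 20 ≤ c ∧ c * ((2 * c) ^ 10 * Real.exp (-2 * c)) ≤ 1 / 40 ∧
      ∃ q : ℝ, 0 < q ∧ q ^ 20 = c ^ 3 * Real.exp (-c) / 2 ∧ q * (216 * 8192 * c ^ 6) ≤ 1 / 2 := by
  filter_upwards [eventually_ge_atTop 20,
    eventually_pow_mul_exp_neg_le 11 (δ := 1 / (40 * 1024)) (by norm_num),
    eventually_pow_mul_exp_neg_le 123 (δ := 2 / (2 * 216 * 8192) ^ 20) (by positivity)]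
    with c hc h1 h2
  have hc0 : 0 < c := by linarith
  refine ⟨hc, ?_, ?_⟩
  · have h3 : Real.exp (-2 * c) ≤ Real.exp (-c) := Real.exp_le_exp.2 (by linarith)
    calc c * ((2 * c) ^ 10 * Real.exp (-2 * c)) ≤ c * ((2 * c) ^ 10 * Real.exp (-c)) := by gcongr
      _ = 1024 * (c ^ 11 * Real.exp (-c)) := by ring
      _ ≤ 1024 * (1 / (40 * 1024)) := by gcongr
      _ = 1 / 40 := by norm_num
  · have hQ : 0 < c ^ 3 * Real.exp (-c) / 2 := by positivity
    obtain ⟨q, hq, hq20⟩ : ∃ q : ℝ, 0 < q ∧ q ^ 20 = c ^ 3 * Real.exp (-c) / 2 :=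
      ⟨_, Real.rpow_pos_of_pos hQ _, Real.rpow_inv_natCast_pow hQ.le (by norm_num)⟩
    refine ⟨q, hq, hq20, ?_⟩
    have h4 : (q * (2 * 216 * 8192 * c ^ 6)) ^ 20 ≤ 1 := by
      calc (q * (2 * 216 * 8192 * c ^ 6)) ^ 20
          = q ^ 20 * (2 * 216 * 8192) ^ 20 * c ^ 120 := by ring
        _ = (2 * 216 * 8192) ^ 20 / 2 * (c ^ 123 * Real.exp (-c)) := by rw [hq20]; ring
        _ ≤ (2 * 216 * 8192) ^ 20 / 2 * (2 / (2 * 216 * 8192) ^ 20) := by gcongr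
        _ = 1 := by norm_num
    have h5 := (pow_le_one_iff_of_nonneg (by positivity) (by norm_num)).1 h4
    linarith

namespace Digraph

theorem IsWitness.le_card {V : Type*} [DecidableEq V] {D : Digraph V} {Z : Set V} {S : Finset V}
    {e z : ℕ} (h : IsWitness D Z S e z) : z ≤ S.card := by
  obtain ⟨F, W, -, -, -, hW, -, rfl⟩ := h
  exact Finset.card_le_card hW

/-- If the filtering process produces more than `a` vertices, then either there are many disjoint
paths of one length between vertices of `Z`, or slightly more than `a` vertices contain many edges
and many vertices of `Z`. -/
theorem exists_hasZPaths_or_isWitness {V : Type*} [Fintype V] [DecidableEq V] {D : Digraph V}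
    {Z : Set V} {a : ℝ} (ha : 0 ≤ a) (h : a < (D.toSimpleGraphInclusive.filterSet Z).ncard) :
    (∃ l ∈ Finset.Icc 1 4, HasZPaths D Z Finset.univ l ⌈a / 20⌉₊) ∨
      ∃ S e z, IsWitness D Z S e z ∧ a < S.card ∧ S.card ≤ a + 5 ∧ S.card ≤ 2 * e ∧
        e ≤ 2 * S.card ∧ 41 * S.card ≤ 40 * e + 20 * z := by
  by_cases hno : ∃ l ∈ Finset.Icc 1 4, HasZPaths D Z Finset.univ l ⌈a / 20⌉₊
  · exact Or.inl hno
  right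
  push Not at hno
  obtain ⟨S, e, z, k, ⟨hw, hp, h1, h2, h3⟩, h4, h5⟩ :=
    exists_isCluster_of_lt_ncard ((Nat.floor_lt ha).2 h)
  have haS : a < S.card := (Nat.floor_lt ha).1 h4
  have hk : ∀ l ∈ Finset.Icc 1 4, 20 * k l ≤ S.card := by
    intro l hl
    have hlt : k l < ⌈a / 20⌉₊ := by
      by_contra! hle
      exact hno l hl (((hp l hl).mono (Finset.subset_univ S)).of_le hle)
    have := Nat.lt_ceil.1 hlt
    have : 20 * (k l : ℝ) ≤ S.card := by linarith
    exact_mod_cast this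
  refine ⟨S, e, z, hw, haS, ?_, h2, h3, ?_⟩
  · have : (S.card : ℝ) ≤ ⌊a⌋₊ + 5 := by exact_mod_cast h5
    linarith [Nat.floor_le ha]
  · -- The disjoint paths cover at most a proportion `(2 + 3 + 4 + 5) / 20` of `S`.
    have hsum : ∑ l ∈ Finset.Icc 1 4, (l + 1) * k l = 2 * k 1 + 3 * k 2 + 4 * k 3 + 5 * k 4 := by
      simp [show Finset.Icc 1 4 = {1, 2, 3, 4} from rfl, add_assoc]
    have hk1 := hk 1 (by simp)
    have hk2 := hk 2 (by simp)
    have hk3 := hk 3 (by simp)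
    have hk4 := hk 4 (by simp)
    lia

/-- An explicit bound, for fixed `n`, for the probability that the filtering process produces more
than `ε n` vertices. -/
theorem real_lt_ncard_filterSet_le {n : ℕ} {c q ε : ℝ} (hc : 20 ≤ c)
    (hε : ε = (2 * c) ^ 10 * Real.exp (-2 * c)) (hq : 0 < q)
    (hqQ : q ^ 20 = c ^ 3 * Real.exp (-c) / 2) (hqc : q * (216 * 8192 * c ^ 6) ≤ 1 / 2)
    (hcn : c ≤ n) (hn : c * (ε * n + 8) ≤ n / 10) (hn5 : 5 ≤ ε * n) :
    (binomialRandom (Fin n) (Set.projIcc (0 : ℝ) 1 zero_le_one (c / n))).real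
      {D | ε * n < ((D.toSimpleGraphInclusive.filterSet {v | D.minDeg v ≤ 3}).ncard : ℝ)} ≤
      4 * (1 / 4) ^ ⌈ε * n / 20⌉₊ +
        (n + 1) * (2 * n + 1) * (n + 1) * ((1 / 2 : ℝ) ^ ε) ^ n := by
  set μ := binomialRandom (Fin n) (Set.projIcc (0 : ℝ) 1 zero_le_one (c / n)) with hμ
  set r := ⌈ε * n / 20⌉₊ with hr
  have hn0 : (0 : ℝ) < n := by linarith
  have ha : 0 ≤ ε * n := by linarith
  let K := ⌊ε * n + 5⌋₊
  have H : ∀ (S W : Finset (Fin n)) (F : Finset (Fin n × Fin n)), S.card ≤ K → W ⊆ S →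
      F ⊆ S.offDiag → μ.real {D | (∀ e ∈ F, D.Adj e.1 e.2) ∧ ∀ v ∈ W, D.minDeg v ≤ 3} ≤
        (c / n) ^ F.card * (c ^ 3 * Real.exp (-c) / 2) ^ W.card := by
    intro S W F hS hW hF
    refine binomialRandom_real_edges_minDeg_le_of_card_le hc hcn ?_ hW hF
    have : (S.card : ℝ) ≤ ε * n + 5 := (Nat.le_floor_iff (by linarith)).1 hS
    refine le_trans (mul_le_mul_of_nonneg_left ?_ (by linarith)) hn
    linarith
  -- the admissible triples `(|S|, e, z)`
  let J : Finset (ℕ × ℕ × ℕ) :=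
    {t ∈ Finset.range (n + 1) ×ˢ Finset.range (2 * n + 1) ×ˢ Finset.range (n + 1) |
      ε * n < t.1 ∧ (t.1 : ℝ) ≤ ε * n + 5 ∧ t.1 ≤ 2 * t.2.1 ∧ t.2.1 ≤ 2 * t.1 ∧
        41 * t.1 ≤ 40 * t.2.1 + 20 * t.2.2}
  let A : ℕ → Set (Digraph (Fin n)) := fun l ↦
    {D | HasZPaths D {v | D.minDeg v ≤ 3} Finset.univ l r}
  let B : ℕ × ℕ × ℕ → Set (Digraph (Fin n)) := fun t ↦
    {D | ∃ S, S.card = t.1 ∧ IsWitness D {v | D.minDeg v ≤ 3} S t.2.1 t.2.2}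
  have hcover : {D : Digraph (Fin n) |
      ε * n < ((D.toSimpleGraphInclusive.filterSet {v | D.minDeg v ≤ 3}).ncard : ℝ)} ⊆
      (⋃ l ∈ Finset.Icc 1 4, A l) ∪ ⋃ t ∈ J, B t := by
    intro D hD
    rcases exists_hasZPaths_or_isWitness ha hD with ⟨l, hl, h⟩ | ⟨S, e, z, hw, h1, h2, h3, h4, h5⟩
    · exact Or.inl (Set.mem_biUnion hl h)
    · refine Or.inr (Set.mem_biUnion (x := (S.card, e, z)) ?_ ⟨S, rfl, hw⟩)
      have hSn : S.card ≤ n := by simpa using S.card_le_univ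
      have hz := hw.le_card
      simp only [J, Finset.coe_filter, Set.mem_ofPred_eq, Finset.mem_product, Finset.mem_range]
      exact ⟨⟨by lia, by lia, by lia⟩, h1, h2, h3, h4, h5⟩
  have hA : ∀ l ∈ Finset.Icc 1 4, μ.real (A l) ≤ (1 / 4) ^ r := by
    intro l hl
    obtain ⟨hl1, hl4⟩ := Finset.mem_Icc.1 hl
    have hK : (l + 1) * r ≤ K := by
      refine Nat.le_floor ?_
      have h1 : (r : ℝ) ≤ ε * n / 20 + 1 := (Nat.ceil_lt_add_one (by linarith)).le
      calc (((l + 1) * r : ℕ) : ℝ) ≤ ((5 * r : ℕ) : ℝ) := by gcongr; lia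
        _ ≤ ε * n + 5 := by push_cast; linarith
    refine (real_hasZPaths_le μ (by positivity) H hl1 hK).trans ?_
    rw [Fintype.card_fin]
    refine zPaths_bound (by linarith) hn0 hl4 ?_
    rw [← hε]
    exact Nat.le_ceil _
  have hB : ∀ t ∈ J, μ.real (B t) ≤ ((1 / 2 : ℝ) ^ ε) ^ n := by
    rintro ⟨s, e, z⟩ ht
    simp only [J, Finset.mem_filter] at ht
    obtain ⟨-, h1, h2, h3, h4, h5⟩ := ht
    refine (real_exists_isWitness_le μ (by positivity) (by positivity) H
      (Nat.le_floor h2)).trans ?_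
    have hs : (0 : ℝ) < s := by linarith
    rw [Fintype.card_fin]
    refine (witness_bound (by linarith) (by exact_mod_cast hn0) (by exact_mod_cast hs) hq hqQ hqc
      ?_ ?_ h3 h4 h5).trans ?_
    · rw [← hε]; exact h1.le
    · rw [← hε]; linarith
    · rw [← Real.rpow_natCast, ← Real.rpow_natCast, ← Real.rpow_mul (by norm_num)]
      exact Real.rpow_le_rpow_of_exponent_ge (by norm_num) (by norm_num) h1.le
  have hJ : (J.card : ℝ) ≤ (n + 1) * (2 * n + 1) * (n + 1) := by
    have : J.card ≤ (n + 1) * ((2 * n + 1) * (n + 1)) :=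
      (Finset.card_filter_le _ _).trans_eq (by simp)
    calc (J.card : ℝ) ≤ ((n + 1) * ((2 * n + 1) * (n + 1)) : ℕ) := by exact_mod_cast this
      _ = _ := by push_cast; ring
  calc _ ≤ μ.real ((⋃ l ∈ Finset.Icc 1 4, A l) ∪ ⋃ t ∈ J, B t) :=
        measureReal_mono hcover (measure_ne_top _ _)
    _ ≤ μ.real (⋃ l ∈ Finset.Icc 1 4, A l) + μ.real (⋃ t ∈ J, B t) := measureReal_union_le _ _
    _ ≤ ∑ l ∈ Finset.Icc 1 4, μ.real (A l) + ∑ t ∈ J, μ.real (B t) :=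
        add_le_add (measureReal_biUnion_finset_le _ _) (measureReal_biUnion_finset_le _ _)
    _ ≤ (Finset.Icc 1 4).card • (1 / 4 : ℝ) ^ r + J.card • ((1 / 2 : ℝ) ^ ε) ^ n :=
        add_le_add (Finset.sum_le_card_nsmul _ _ _ hA) (Finset.sum_le_card_nsmul _ _ _ hB)
    _ ≤ _ := by
        rw [nsmul_eq_mul, nsmul_eq_mul]
        gcongr
        simp

theorem tendsto_error_term {ε : ℝ} (hε : 0 < ε) :
    Tendsto (fun n : ℕ ↦ 4 * (1 / 4 : ℝ) ^ ⌈ε * n / 20⌉₊ +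
      (n + 1) * (2 * n + 1) * (n + 1) * ((1 / 2 : ℝ) ^ ε) ^ n) atTop (𝓝 0) := by
  have h1 : Tendsto (fun n : ℕ ↦ 4 * (1 / 4 : ℝ) ^ ⌈ε * n / 20⌉₊) atTop (𝓝 0) := by
    have : Tendsto (fun n : ℕ ↦ ε * n / 20) atTop atTop :=
      (tendsto_natCast_atTop_atTop.const_mul_atTop hε).atTop_div_const (by norm_num)
    simpa using ((tendsto_pow_atTop_nhds_zero_of_lt_one (r := (1 / 4 : ℝ)) (by norm_num)
      (by norm_num)).comp (tendsto_nat_ceil_atTop.comp this)).const_mul 4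
  have hρ0 : 0 < (1 / 2 : ℝ) ^ ε := by positivity
  have hρ1 : |(1 / 2 : ℝ) ^ ε| < 1 := by
    rw [abs_of_pos hρ0]
    exact Real.rpow_lt_one (by norm_num) (by norm_num) hε
  have h (k : ℕ) := tendsto_pow_const_mul_const_pow_of_abs_lt_one k hρ1
  have h2 := ((((h 3).const_mul 2).add ((h 2).const_mul 5)).add ((h 1).const_mul 4)).add (h 0)
  have h3 := h1.add h2
  simp only [mul_zero, add_zero] at h3
  refine h3.congr fun n ↦ ?_
  ring

end Digraph
end

theorem mainTheorem2 :
    ∃ c₀ : ℝ, ∀ c : ℝ, 1 < c → c₀ ≤ c →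
      Tendsto
        (fun n : ℕ =>
          Digraph.binomialRandom (Fin n) (Set.projIcc (0 : ℝ) 1 zero_le_one (c / n))
            {D | ((D.toSimpleGraphInclusive.filterSet {v | D.minDeg v ≤ 3}).ncard : ℝ) ≤
              (2 * c) ^ 10 * Real.exp (-2 * c) * n})
        atTop (𝓝 1) := by
  obtain ⟨c₀, hc₀⟩ := eventually_atTop.1 eventually_parameters
  refine ⟨c₀, fun c _ hc ↦ ?_⟩
  obtain ⟨hc20, hcε, q, hq, hqQ, hqc⟩ := hc₀ c hc
  set ε := (2 * c) ^ 10 * Real.exp (-2 * c) with hε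
  have hε0 : 0 < ε := by positivity
  let μ (n : ℕ) := Digraph.binomialRandom (Fin n) (Set.projIcc (0 : ℝ) 1 zero_le_one (c / n))
  let A (n : ℕ) : Set (Digraph (Fin n)) :=
    {D | ((D.toSimpleGraphInclusive.filterSet {v | D.minDeg v ≤ 3}).ncard : ℝ) ≤ ε * n}
  have hreal : Tendsto (fun n ↦ (μ n).real (A n)ᶜ) atTop (𝓝 0) := by
    refine squeeze_zero' (Eventually.of_forall fun _ ↦ measureReal_nonneg) ?_
      (Digraph.tendsto_error_term hε0)
    filter_upwards [eventually_ge_atTop ⌈c⌉₊, eventually_ge_atTop ⌈5 / ε⌉₊,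
      eventually_ge_atTop ⌈320 * c⌉₊] with n h1 h2 h3
    -- For `n ≥ 320 c`, the inequality `c ε ≤ 1 / 40` absorbs the rounding errors.
    rw [Nat.ceil_le] at h1 h2 h3
    rw [div_le_iff₀ hε0] at h2
    have : (A n)ᶜ = {D | ε * n <
        ((D.toSimpleGraphInclusive.filterSet {v | D.minDeg v ≤ 3}).ncard : ℝ)} := by
      ext D
      simp [A]
    rw [this]
    refine Digraph.real_lt_ncard_filterSet_le hc20 hε hq hqQ hqc h1 ?_ (by linarith)
    have : c * ε * n ≤ 1 / 40 * n := by gcongr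
    linarith
  have hone : Tendsto (fun n ↦ (μ n).real (A n)) atTop (𝓝 1) := by
    have := hreal.const_sub 1
    rw [sub_zero] at this
    refine this.congr fun n ↦ ?_
    rw [probReal_compl_eq_one_sub MeasurableSpace.measurableSet_top]
    ring
  have := ENNReal.tendsto_ofReal hone
  simpa [μ, A, ofReal_measureReal] using this
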